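/- A disjunctive identity (d-identity) is a sentence $\forall x_0,x_1,\dots\;[(f_1=1)\vee\dots\vee(f_m=1)]$, where $f_1,\dots,f_m$ are group words in the variables $x_0,x_1,\dots$; an equation $u=v$ between words stands for $uv^{-1}=1$. A set $\Delta$ of d-identities is a basis of d-identities of a group $G$ if every member of $\Delta$ holds in $G$ and every group in which all members of $\Delta$ hold satisfies all d-identities of $G$. A section of $G$ is a group isomorphic to a quotient of a subgroup of $G$. Theorem 1. The following five formulas form a basis of d-identities of the alternating group $A_5$: $$\omega_{60}=\bigvee_{0\le i<j\le 60}(x_i=x_j),$$ $$(x^2=1)\vee(x^3=1)\vee(x^5=1),\tag{3.1}$$ $$\Big[\bigvee_{1\le i\le 3}x_i^{15}=1\Big]\vee\Big[\bigvee_{1\le i<j\le 3}(x_ix_j)^{15}=1\Big]\vee\Big[\bigvee_{(i,j,k)\in\{0,1\}^3\setminus\{0\}}x_1^ix_2^jx_3^k=1\Big],\tag{3.2}$$ $$(x_1^{10}=1)\vee(x_2^{10}=1)\vee(x_1=x_2)\vee((x_1x_2)^{10}=1)\vee((x_1^2x_2)^2=1),\tag{3.3}$$ $$(x_1^6=1)\vee(x_2^6=1)\vee((x_1x_2)^6=1)\vee((x_1x_2^2)^6=1)\vee((x_1x_2^3)^6=1)\vee((x_1x_2^4)^6=1).\tag{3.4}$$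 Moreover, every group (finite or infinite) in which all five formulas hold is a section of $A_5$. -/

import Mathlib

universe u v

/-- A disjunctive identity `(f₁ = 1) ∨ ⋯ ∨ (fₙ = 1)`, universally quantified over its variables, is
given by the list of the words `f₁, …, fₙ` in the free group on the variables `x₀, x₁, x₂, …`. An
equation `u = v` between two words is recorded as the word `u * v⁻¹`. The empty disjunction is
false in every group. -/
abbrev DIdentity : Type := List (FreeGroup ℕ)

namespace DIdentity

/-- `δ.HoldsIn G`: the disjunctive identity `δ` is identically true on the group `G`. -/
def HoldsIn (δ : DIdentity) (G : Type*) [Group G] : Prop :=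
  ∀ g : ℕ → G, ∃ f ∈ δ, FreeGroup.lift g f = 1

/-- The variable `xᵢ`. -/
def x (i : ℕ) : FreeGroup ℕ := FreeGroup.of i

/-- `ωₙ`: the disjunction of `xᵢ = xⱼ` over `0 ≤ i < j ≤ n`. -/
def omega (n : ℕ) : DIdentity :=
  (List.range (n + 1)).flatMap fun j => (List.range j).map fun i => x i * (x j)⁻¹

/-- `(x² = 1) ∨ (x³ = 1) ∨ (x⁵ = 1)`. -/
def alpha : DIdentity := [x 1 ^ 2, x 1 ^ 3, x 1 ^ 5]

/-- `⋁ᵢ (xᵢ¹⁵ = 1) ∨ ⋁_{i<j} ((xᵢ xⱼ)¹⁵ = 1) ∨ ⋁ (x₁ⁱ x₂ʲ x₃ᵏ = 1)`, the last disjunction over all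
nonzero vectors `(i, j, k)` with entries in `{0, 1}`. -/
def beta : DIdentity :=
  [x 1 ^ 15, x 2 ^ 15, x 3 ^ 15] ++
  [(x 1 * x 2) ^ 15, (x 1 * x 3) ^ 15, (x 2 * x 3) ^ 15] ++
  [x 1, x 2, x 3, x 1 * x 2, x 1 * x 3, x 2 * x 3, x 1 * x 2 * x 3]

/-- `(x₁¹⁰ = 1) ∨ (x₂¹⁰ = 1) ∨ (x₁ = x₂) ∨ ((x₁ x₂)¹⁰ = 1) ∨ ((x₁² x₂)² = 1)`. -/
def gamma : DIdentity :=
  [x 1 ^ 10, x 2 ^ 10, x 1 * (x 2)⁻¹, (x 1 * x 2) ^ 10, (x 1 ^ 2 * x 2) ^ 2]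

/-- `(x₁⁶ = 1) ∨ (x₂⁶ = 1) ∨ ((x₁ x₂)⁶ = 1) ∨ ((x₁ x₂²)⁶ = 1) ∨ ((x₁ x₂³)⁶ = 1) ∨
((x₁ x₂⁴)⁶ = 1)`. -/
def epsilon : DIdentity :=
  [x 1 ^ 6, x 2 ^ 6, (x 1 * x 2) ^ 6, (x 1 * x 2 ^ 2) ^ 6, (x 1 * x 2 ^ 3) ^ 6,
    (x 1 * x 2 ^ 4) ^ 6]

/-- The five disjunctive identities proposed as a basis for the alternating group of degree 5. -/
def basisA5 : Set DIdentity := {omega 60, alpha, beta, gamma, epsilon}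

end DIdentity

/-- `H` belongs to the d-variety generated by `G`: it satisfies all disjunctive identities of `G`. -/
def MemDVar (H G : Type*) [Group H] [Group G] : Prop :=
  ∀ δ : DIdentity, δ.HoldsIn G → δ.HoldsIn H

/-- `Δ` is a basis of disjunctive identities of `G`: every member of `Δ` holds in `G`, and every
group (in the universe `u`) satisfying all members of `Δ` belongs to the d-variety generated
by `G`. -/
def IsDBasis (Δ : Set DIdentity) (G : Type v) [Group G] : Prop :=
  (∀ δ ∈ Δ, δ.HoldsIn G) ∧
    ∀ (H : Type u) [Group H], (∀ δ ∈ Δ, δ.HoldsIn H) → MemDVar H G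

/-- `H` is a section of `G`: it is isomorphic to a quotient of a subgroup of `G`. -/
def IsSection (H G : Type*) [Group H] [Group G] : Prop :=
  ∃ (K : Subgroup G) (N : Subgroup K) (_ : N.Normal), Nonempty (H ≃* K ⧸ N)

/-!
A group satisfying the five identities is finite, all its nontrivial elements have order 2, 3 or 5,
and its Sylow subgroups have order dividing 4, 3 and 5; so its order divides 60. Two commuting
nontrivial elements of such a group have the same order, since otherwise their product would have
composite order. Hence an element acts by conjugation without fixed points on any normal subgroup of
order coprime to its own. These actions rule out the orders 15, 20 and 30. In the remaining cases
they show that the group is cyclic of prime order, dihedral of order 4, 6 or 10, or acts faithfully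
as an alternating group on the cosets of a subgroup of index 4 or 5; all of these groups embed
in `A₅`.
-/

open Equiv Equiv.Perm

theorem map_freeGroup_lift {ι G H : Type*} [Group G] [Group H] (φ : G →* H) (g : ι → G)
    (w : FreeGroup ι) : φ (FreeGroup.lift g w) = FreeGroup.lift (φ ∘ g) w :=
  DFunLike.congr_fun
    (FreeGroup.ext_hom (φ.comp (FreeGroup.lift g)) (FreeGroup.lift (φ ∘ g)) fun i => by simp) w

namespace DIdentity

variable {G H : Type*} [Group G] [Group H] {δ : DIdentity}

theorem HoldsIn.of_injective (h : δ.HoldsIn G) {φ : H →* G} (hφ : Function.Injective φ) :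
    δ.HoldsIn H := by
  intro g
  obtain ⟨f, hf, hf1⟩ := h (φ ∘ g)
  exact ⟨f, hf, hφ (by rw [map_freeGroup_lift, hf1, map_one])⟩

theorem HoldsIn.of_surjective (h : δ.HoldsIn G) {φ : G →* H} (hφ : Function.Surjective φ) :
    δ.HoldsIn H := by
  intro g
  obtain ⟨k, rfl⟩ := hφ.comp_left g
  obtain ⟨f, hf, hf1⟩ := h k
  exact ⟨f, hf, by rw [← map_freeGroup_lift, hf1, map_one]⟩

theorem holdsIn_of_forall_exists_isConj {S : Set G} (hS : ∀ a : G, ∃ s ∈ S, IsConj a s) (i : ℕ)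
    (h : ∀ g : ℕ → G, g i ∈ S → ∃ f ∈ δ, FreeGroup.lift g f = 1) : δ.HoldsIn G := by
  intro g
  obtain ⟨s, hs, hgs⟩ := hS (g i)
  obtain ⟨c, rfl⟩ := isConj_iff.1 hgs
  obtain ⟨f, hf, hf1⟩ := h (MulAut.conj c ∘ g) hs
  refine ⟨f, hf, (MulAut.conj c).injective ?_⟩
  rw [map_one, ← hf1]
  exact map_freeGroup_lift (MulAut.conj c).toMonoidHom g f

theorem omega_holdsIn_iff {n : ℕ} :
    (omega n).HoldsIn G ↔ ∀ g : ℕ → G, ∃ i j, i < j ∧ j ≤ n ∧ g i = g j := by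
  refine forall_congr' fun g => ?_
  simp only [omega, x, List.mem_flatMap, List.mem_range, List.mem_map, Nat.lt_succ_iff]
  constructor
  · rintro ⟨f, ⟨j, hj, i, hij, rfl⟩, h⟩
    exact ⟨i, j, hij, hj, by simpa [mul_inv_eq_one] using h⟩
  · rintro ⟨i, j, hij, hj, h⟩
    exact ⟨_, ⟨j, hj, i, hij, rfl⟩, by simpa [mul_inv_eq_one] using h⟩

theorem alpha_holdsIn_iff : alpha.HoldsIn G ↔ ∀ a : G, a ^ 2 = 1 ∨ a ^ 3 = 1 ∨ a ^ 5 = 1 := by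
  constructor
  · intro h a
    simpa [alpha, x] using h fun _ => a
  · intro h g
    simpa [alpha, x] using h (g 1)

theorem beta_holdsIn_iff : beta.HoldsIn G ↔ ∀ a b c : G,
    a ^ 15 = 1 ∨ b ^ 15 = 1 ∨ c ^ 15 = 1 ∨ (a * b) ^ 15 = 1 ∨ (a * c) ^ 15 = 1 ∨
      (b * c) ^ 15 = 1 ∨ a = 1 ∨ b = 1 ∨ c = 1 ∨ a * b = 1 ∨ a * c = 1 ∨ b * c = 1 ∨
      a * b * c = 1 := by
  constructor
  · intro h a b c
    simpa [beta, x] using h fun n => if n = 1 then a else if n = 2 then b else c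
  · intro h g
    simpa [beta, x] using h (g 1) (g 2) (g 3)

theorem gamma_holdsIn_iff : gamma.HoldsIn G ↔ ∀ a b : G,
    a ^ 10 = 1 ∨ b ^ 10 = 1 ∨ a = b ∨ (a * b) ^ 10 = 1 ∨ (a ^ 2 * b) ^ 2 = 1 := by
  constructor
  · intro h a b
    simpa [gamma, x, mul_inv_eq_one] using h fun n => if n = 1 then a else b
  · intro h g
    simpa [gamma, x, mul_inv_eq_one] using h (g 1) (g 2)

theorem epsilon_holdsIn_iff : epsilon.HoldsIn G ↔ ∀ a b : G,
    a ^ 6 = 1 ∨ b ^ 6 = 1 ∨ (a * b) ^ 6 = 1 ∨ (a * b ^ 2) ^ 6 = 1 ∨ (a * b ^ 3) ^ 6 = 1 ∨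
      (a * b ^ 4) ^ 6 = 1 := by
  constructor
  · intro h a b
    simpa [epsilon, x] using h fun n => if n = 1 then a else b
  · intro h g
    simpa [epsilon, x] using h (g 1) (g 2)

theorem finite_of_omega_holdsIn {n : ℕ} (h : (omega n).HoldsIn G) : Finite G := by
  by_contra hinf
  rw [not_finite_iff_infinite] at hinf
  obtain ⟨i, j, hij, -, he⟩ := omega_holdsIn_iff.1 h (Infinite.natEmbedding G)
  exact hij.ne ((Infinite.natEmbedding G).injective he)

theorem omega_holdsIn_of_card_le {n : ℕ} [Finite G] (h : Nat.card G ≤ n) :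
    (omega n).HoldsIn G := by
  rw [omega_holdsIn_iff]
  intro g
  have hg : ¬ Function.Injective fun i : Fin (n + 1) => g i := fun hinj => by
    simpa using (Nat.card_le_card_of_injective _ hinj).trans h
  obtain ⟨i, j, he, hij⟩ := Function.not_injective_iff.1 hg
  rcases lt_or_gt_of_ne hij with hlt | hlt
  · exact ⟨i, j, hlt, by omega, he⟩
  · exact ⟨j, i, hlt, by omega, he.symm⟩

end DIdentity

theorem MemDVar.of_isSection {G H : Type*} [Group G] [Group H] (h : IsSection H G) :
    MemDVar H G := by
  obtain ⟨K, N, _, ⟨e⟩⟩ := h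
  intro δ hδ
  exact ((hδ.of_injective K.subtype_injective).of_surjective
    (QuotientGroup.mk'_surjective N)).of_injective (φ := e.toMonoidHom) e.injective

theorem IsSection.of_injective {G H : Type*} [Group G] [Group H] {φ : H →* G}
    (hφ : Function.Injective φ) : IsSection H G :=
  ⟨φ.range, ⊥, inferInstance,
    ⟨(MonoidHom.ofInjective hφ).trans QuotientGroup.quotientBot.symm⟩⟩

namespace alternatingGroupFive

theorem nat_card : Nat.card (alternatingGroup (Fin 5)) = 60 := by
  rw [nat_card_alternatingGroup, Nat.card_fin]
  rfl

/-- One element from each conjugacy class of `A₅`; the two classes of 5-cycles are represented by a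
5-cycle and its square. -/
def classRepresentatives : Finset (alternatingGroup (Fin 5)) :=
  {1, ⟨c[0, 1] * c[2, 3], mem_alternatingGroup.2 (by decide +kernel)⟩,
    ⟨c[0, 1, 2], mem_alternatingGroup.2 (by decide +kernel)⟩,
    ⟨c[0, 1, 2, 3, 4], mem_alternatingGroup.2 (by decide +kernel)⟩,
    ⟨c[0, 2, 4, 1, 3], mem_alternatingGroup.2 (by decide +kernel)⟩}

theorem exists_isConj_classRepresentatives (a : alternatingGroup (Fin 5)) :
    ∃ s ∈ classRepresentatives, IsConj a s := by
  simp only [isConj_iff]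
  revert a
  decide +kernel

theorem alpha_holdsIn : DIdentity.alpha.HoldsIn (alternatingGroup (Fin 5)) := by
  rw [DIdentity.alpha_holdsIn_iff]
  decide +kernel

theorem beta_holdsIn : DIdentity.beta.HoldsIn (alternatingGroup (Fin 5)) := by
  -- The disjuncts without `c` stand before `∀ c`, so that `c` is enumerated for few pairs only.
  have check : ∀ a ∈ classRepresentatives, ∀ b, a ^ 15 = 1 ∨ b ^ 15 = 1 ∨ (a * b) ^ 15 = 1 ∨
      ∀ c, c ^ 15 = 1 ∨ (a * c) ^ 15 = 1 ∨ (b * c) ^ 15 = 1 ∨ a * b = 1 ∨ a * c = 1 ∨ b * c = 1 ∨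
        a * b * c = 1 := by
    decide +kernel
  refine DIdentity.holdsIn_of_forall_exists_isConj exists_isConj_classRepresentatives 1
    fun g hg => ?_
  have := check (g 1) hg (g 2)
  simp only [DIdentity.beta, DIdentity.x, List.cons_append, List.nil_append, List.mem_cons,
    List.not_mem_nil, or_false, exists_eq_or_imp, exists_eq_left, map_pow, map_mul,
    FreeGroup.lift_apply_of]
  grind

theorem gamma_holdsIn : DIdentity.gamma.HoldsIn (alternatingGroup (Fin 5)) := by
  have check : ∀ a ∈ classRepresentatives, ∀ b,
      a ^ 10 = 1 ∨ b ^ 10 = 1 ∨ a = b ∨ (a * b) ^ 10 = 1 ∨ (a ^ 2 * b) ^ 2 = 1 := by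
    decide +kernel
  refine DIdentity.holdsIn_of_forall_exists_isConj exists_isConj_classRepresentatives 1
    fun g hg => ?_
  simpa [DIdentity.gamma, DIdentity.x, mul_inv_eq_one] using check (g 1) hg (g 2)

theorem epsilon_holdsIn : DIdentity.epsilon.HoldsIn (alternatingGroup (Fin 5)) := by
  have check : ∀ a ∈ classRepresentatives, ∀ b, a ^ 6 = 1 ∨ b ^ 6 = 1 ∨ (a * b) ^ 6 = 1 ∨
      (a * b ^ 2) ^ 6 = 1 ∨ (a * b ^ 3) ^ 6 = 1 ∨ (a * b ^ 4) ^ 6 = 1 := by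
    decide +kernel
  refine DIdentity.holdsIn_of_forall_exists_isConj exists_isConj_classRepresentatives 1
    fun g hg => ?_
  simpa [DIdentity.epsilon, DIdentity.x] using check (g 1) hg (g 2)

theorem basisA5_holdsIn : ∀ δ ∈ DIdentity.basisA5, δ.HoldsIn (alternatingGroup (Fin 5)) := by
  rintro δ (rfl | rfl | rfl | rfl | rfl)
  exacts [DIdentity.omega_holdsIn_of_card_le nat_card.le, alpha_holdsIn, beta_holdsIn,
    gamma_holdsIn, epsilon_holdsIn]

end alternatingGroupFive

/-- Every nontrivial element of `G` has prime order. Finite groups with this property, of order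
dividing 60, are the ones to be classified. -/
def HasPrimeOrders (G : Type*) [Group G] : Prop :=
  ∀ a : G, a ≠ 1 → (orderOf a).Prime

namespace HasPrimeOrders

variable {G : Type*} [Group G]

theorem of_pow_eq_one (h : ∀ a : G, a ^ 2 = 1 ∨ a ^ 3 = 1 ∨ a ^ 5 = 1) : HasPrimeOrders G := by
  have : Fact (Nat.Prime 5) := ⟨Nat.prime_five⟩
  intro a ha
  rcases h a with h | h | h
  · exact orderOf_eq_prime h ha ▸ Nat.prime_two
  · exact orderOf_eq_prime h ha ▸ Nat.prime_three
  · exact orderOf_eq_prime h ha ▸ Nat.prime_five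

theorem subgroup (hG : HasPrimeOrders G) (K : Subgroup G) : HasPrimeOrders K := by
  intro a ha
  rw [← Subgroup.orderOf_coe]
  exact hG a (by simpa using ha)

theorem orderOf_eq_of_commute (hG : HasPrimeOrders G) {a b : G} (h : Commute a b) (ha : a ≠ 1)
    (hb : b ≠ 1) : orderOf a = orderOf b := by
  have hpa := hG a ha
  have hpb := hG b hb
  by_contra hab
  have ho := h.orderOf_mul_eq_mul_orderOf_of_coprime ((Nat.coprime_primes hpa hpb).2 hab)
  have hne : a * b ≠ 1 := by
    intro h1
    rw [h1, orderOf_one] at ho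
    exact hpa.one_lt.ne' (Nat.eq_one_of_mul_eq_one_right ho.symm)
  exact Nat.not_prime_mul hpa.one_lt.ne' hpb.one_lt.ne' (ho ▸ hG _ hne)

theorem pow_eq_one_of_pow_pow_eq_one (hG : HasPrimeOrders G) {p n : ℕ} {a : G}
    (h : a ^ p ^ n = 1) : a ^ p = 1 := by
  rcases eq_or_ne a 1 with rfl | ha
  · exact one_pow p
  · have hdvd : orderOf a ∣ p := (hG a ha).dvd_of_dvd_pow (orderOf_dvd_of_pow_eq_one h)
    exact orderOf_dvd_iff_pow_eq_one.1 hdvd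

theorem exists_subgroup_card_eq_pow_forall_pow_eq_one [Finite G] (hG : HasPrimeOrders G) {p n : ℕ}
    (hp : p.Prime) (h : p ^ n ∣ Nat.card G) :
    ∃ K : Subgroup G, Nat.card K = p ^ n ∧ ∀ k : K, k ^ p = 1 := by
  have : Fact p.Prime := ⟨hp⟩
  obtain ⟨K, hK⟩ := Sylow.exists_subgroup_card_pow_prime p h
  exact ⟨K, hK, fun k => (hG.subgroup K).pow_eq_one_of_pow_pow_eq_one (hK ▸ pow_card_eq_one')⟩

end HasPrimeOrders

theorem pow_eq_one_iff_of_pow_eq_one {G : Type*} [Group G] {a : G} {m n : ℕ} (hm : a ^ m = 1)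
    (h : m.Coprime n) : a ^ n = 1 ↔ a = 1 :=
  (and_iff_right hm).symm.trans (pow_eq_one_iff_of_coprime h)

theorem exists_notMem_of_card_lt {α : Type*} (s : Finset α) (h : s.card < Nat.card α) :
    ∃ a, a ∉ s := by
  by_contra! hs
  have : Fintype α := ⟨s, hs⟩
  rw [Nat.card_eq_fintype_card] at h
  exact h.not_ge (Finset.card_le_card fun a _ => hs a)

theorem natCard_dvd_of_forall_mem_zpowers {G : Type*} [Group G] {p : ℕ} (hpow : ∀ a : G, a ^ p = 1)
    (h : ∀ a b : G, a ≠ 1 → b ∈ Subgroup.zpowers a) : Nat.card G ∣ p := by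
  rcases subsingleton_or_nontrivial G with _ | _
  · rw [Nat.card_unique]
    exact one_dvd p
  · obtain ⟨a, ha⟩ := exists_ne (1 : G)
    rw [← orderOf_eq_card_of_forall_mem_zpowers fun b => h a b ha]
    exact orderOf_dvd_of_pow_eq_one (hpow a)

namespace DIdentity

variable {G : Type*} [Group G]

theorem card_le_four_of_beta_holdsIn (h : beta.HoldsIn G) (hpow : ∀ a : G, a ^ 2 = 1) :
    Nat.card G ≤ 4 := by
  classical
  by_contra! hcard
  obtain ⟨a, ha⟩ := exists_notMem_of_card_lt {(1 : G)}
    (Finset.card_singleton (1 : G) |>.trans_lt (by omega))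
  obtain ⟨b, hb⟩ := exists_notMem_of_card_lt {1, a} (Finset.card_le_two.trans_lt (by omega))
  obtain ⟨c, hc⟩ := exists_notMem_of_card_lt {1, a, b, a * b}
    (Finset.card_le_four.trans_lt hcard)
  have hinv (k : G) : k⁻¹ = k := inv_eq_of_mul_eq_one_left (by rw [← sq, hpow])
  have h15 (k : G) : k ^ 15 = 1 ↔ k = 1 := pow_eq_one_iff_of_pow_eq_one (hpow k) (by norm_num)
  have := beta_holdsIn_iff.1 h a b c
  simp only [h15, mul_eq_one_iff_inv_eq, hinv, Finset.mem_insert, Finset.mem_singleton, not_or]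
    at this ha hb hc
  grind

theorem card_dvd_three_of_gamma_holdsIn (h : gamma.HoldsIn G) (hpow : ∀ a : G, a ^ 3 = 1) :
    Nat.card G ∣ 3 := by
  refine natCard_dvd_of_forall_mem_zpowers hpow fun a b ha => ?_
  have h10 (k : G) : k ^ 10 = 1 ↔ k = 1 := pow_eq_one_iff_of_pow_eq_one (hpow k) (by norm_num)
  have h2 (k : G) : k ^ 2 = 1 ↔ k = 1 := pow_eq_one_iff_of_pow_eq_one (hpow k) (by norm_num)
  have := gamma_holdsIn_iff.1 h a b
  simp only [h10, h2, ha, false_or, mul_eq_one_iff_inv_eq] at this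
  rcases this with rfl | rfl | rfl | rfl
  · exact one_mem _
  · exact Subgroup.mem_zpowers a
  · exact inv_mem (Subgroup.mem_zpowers a)
  · exact inv_mem (pow_mem (Subgroup.mem_zpowers a) 2)

theorem card_dvd_five_of_epsilon_holdsIn (h : epsilon.HoldsIn G) (hpow : ∀ a : G, a ^ 5 = 1) :
    Nat.card G ∣ 5 := by
  refine natCard_dvd_of_forall_mem_zpowers hpow fun a b ha => ?_
  have h6 (k : G) : k ^ 6 = 1 ↔ k = 1 := pow_eq_one_iff_of_pow_eq_one (hpow k) (by norm_num)
  have := epsilon_holdsIn_iff.1 h b a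
  simp only [h6, ha, false_or, mul_eq_one_iff_eq_inv] at this
  rcases this with rfl | rfl | rfl | rfl | rfl
  · exact one_mem _
  · exact inv_mem (Subgroup.mem_zpowers a)
  all_goals exact inv_mem (pow_mem (Subgroup.mem_zpowers a) _)

end DIdentity

theorem card_dvd_sixty {G : Type*} [Group G] [Finite G] (hα : DIdentity.alpha.HoldsIn G)
    (hβ : DIdentity.beta.HoldsIn G) (hγ : DIdentity.gamma.HoldsIn G)
    (hε : DIdentity.epsilon.HoldsIn G) : Nat.card G ∣ 60 := by
  rw [DIdentity.alpha_holdsIn_iff] at hα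
  rw [Nat.dvd_iff_prime_pow_dvd_dvd]
  intro p k hp hk
  rcases k.eq_zero_or_pos with rfl | hk0
  · exact one_dvd 60
  have : Fact p.Prime := ⟨hp⟩
  obtain ⟨a, ha⟩ := exists_prime_orderOf_dvd_card' (G := G) p ((dvd_pow_self p hk0.ne').trans hk)
  have hp235 : p = 2 ∨ p = 3 ∨ p = 5 := by
    simpa only [← orderOf_dvd_iff_pow_eq_one, ha, Nat.prime_dvd_prime_iff_eq hp Nat.prime_two,
      Nat.prime_dvd_prime_iff_eq hp Nat.prime_three, Nat.prime_dvd_prime_iff_eq hp Nat.prime_five]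
      using hα a
  obtain ⟨K, hK, hpow⟩ :=
    (HasPrimeOrders.of_pow_eq_one hα).exists_subgroup_card_eq_pow_forall_pow_eq_one hp hk
  rw [← hK]
  rcases hp235 with rfl | rfl | rfl
  · have hle := DIdentity.card_le_four_of_beta_holdsIn (hβ.of_injective K.subtype_injective) hpow
    rw [hK] at hle ⊢
    have hk2 : k ≤ 2 := (Nat.pow_le_pow_iff_right one_lt_two).1 hle
    exact (pow_dvd_pow 2 hk2).trans (by norm_num)
  · exact (DIdentity.card_dvd_three_of_gamma_holdsIn
      (hγ.of_injective K.subtype_injective) hpow).trans (by norm_num)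
  · exact (DIdentity.card_dvd_five_of_epsilon_holdsIn
      (hε.of_injective K.subtype_injective) hpow).trans (by norm_num)

theorem card_sylow_eq_of_card_eq_pow_mul {G : Type*} [Group G] [Finite G] {p k m : ℕ}
    [hp : Fact p.Prime] (P : Sylow p G) (hcard : Nat.card G = p ^ k * m) (hm : ¬ p ∣ m) :
    Nat.card P = p ^ k := by
  have hm0 : m ≠ 0 := fun h => hm (h ▸ dvd_zero p)
  rw [P.card_eq_multiplicity, hcard, Nat.factorization_mul (pow_ne_zero _ hp.out.ne_zero) hm0,
    Finsupp.add_apply, hp.out.factorization_pow, Finsupp.single_eq_same,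
    Nat.factorization_eq_zero_of_not_dvd hm, add_zero]

theorem exists_normal_card_eq_of_minFac {G : Type*} [Group G] [Finite G] {p m : ℕ}
    [hp : Fact p.Prime] (hcard : Nat.card G = p * m) (hm : ¬ p ∣ m)
    (hmin : (Nat.card G).minFac = p) : ∃ K : Subgroup G, K.Normal ∧ Nat.card K = m := by
  obtain ⟨P⟩ : Nonempty (Sylow p G) := inferInstance
  have hP : Nat.card P = p := by
    simpa using card_sylow_eq_of_card_eq_pow_mul (k := 1) P (by simpa using hcard) hm
  have hcyc : IsCyclic P := isCyclic_of_prime_card hP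
  refine ⟨(MonoidHom.transferSylow P (hcyc.normalizer_le_centralizer hmin)).ker, inferInstance, ?_⟩
  have h := (hcyc.isComplement' hmin).card_mul_card
  rw [hcard, mul_comm p, hP] at h
  exact Nat.eq_of_mul_eq_mul_right hp.out.pos h

namespace HasPrimeOrders

variable {G : Type*} [Group G]

theorem fixedPointFree_conjNormal (hG : HasPrimeOrders G) {K : Subgroup G} [K.Normal] {g : G}
    (hg : g ≠ 1) (hgK : (orderOf g).Coprime (Nat.card K)) :
    MonoidHom.FixedPointFree (MulAut.conjNormal g : MulAut K) := by
  intro k hk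
  by_contra hk1
  have hcomm : Commute g (k : G) := by
    have := congrArg Subtype.val hk
    rwa [MulAut.conjNormal_apply, mul_inv_eq_iff_eq_mul] at this
  have hord : orderOf g = orderOf k := by
    rw [← Subgroup.orderOf_coe, hG.orderOf_eq_of_commute hcomm hg (by simpa using hk1)]
  exact (hG g hg).one_lt.ne' (hgK.eq_one_of_dvd (hord ▸ orderOf_dvd_natCard k))

theorem card_modEq_one_of_normal [Finite G] (hG : HasPrimeOrders G) {p : ℕ} (hp : p.Prime)
    (hpG : p ∣ Nat.card G) (K : Subgroup G) [K.Normal] (hpK : ¬ p ∣ Nat.card K) :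
    Nat.card K ≡ 1 [MOD p] := by
  have : Fact p.Prime := ⟨hp⟩
  obtain ⟨g, hg⟩ := exists_prime_orderOf_dvd_card' (G := G) p hpG
  have hg1 : g ≠ 1 := orderOf_eq_one_iff.not.1 (hg ▸ hp.ne_one)
  have hfree := hG.fixedPointFree_conjNormal hg1
    (hg.symm ▸ (Nat.Prime.coprime_iff_not_dvd hp).2 hpK)
  let _ : MulAction (Subgroup.zpowers g) K :=
    MulAction.compHom K ((MulAut.conjNormal : G →* MulAut K).comp (Subgroup.zpowers g).subtype)
  have hfix : MulAction.fixedPoints (Subgroup.zpowers g) K = {1} := by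
    ext k
    refine ⟨fun hk => hfree k (hk ⟨g, Subgroup.mem_zpowers g⟩), ?_⟩
    rintro rfl c
    exact map_one (MulAut.conjNormal (c : G) : MulAut K)
  have hpg : IsPGroup p (Subgroup.zpowers g) := .of_card (n := 1) (by simp [hg])
  simpa [hfix] using hpg.card_modEq_card_fixedPoints K

theorem card_modEq_one_of_dvd_card_normalizer [Finite G] (hG : HasPrimeOrders G) {p : ℕ}
    (hp : p.Prime) (K : Subgroup G) (hpN : p ∣ Nat.card (Subgroup.normalizer (K : Set G)))
    (hpK : ¬ p ∣ Nat.card K) : Nat.card K ≡ 1 [MOD p] := by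
  have hK : Nat.card (K.subgroupOf (Subgroup.normalizer (K : Set G))) = Nat.card K :=
    Nat.card_congr (Subgroup.subgroupOfEquivOfLe Subgroup.le_normalizer).toEquiv
  rw [← hK] at hpK ⊢
  exact (hG.subgroup _).card_modEq_one_of_normal hp hpN _ hpK

theorem conjNormal_eq_inv (hG : HasPrimeOrders G) {K : Subgroup G} [K.Normal]
    (hK : Odd (Nat.card K)) {s : G} (hs : orderOf s = 2) (a : K) :
    MulAut.conjNormal s a = a⁻¹ := by
  have : Finite K := Nat.finite_of_card_ne_zero hK.pos.ne'
  have hs1 : s ≠ 1 := orderOf_eq_one_iff.not.1 (by omega)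
  have hfree := hG.fixedPointFree_conjNormal hs1 (hs ▸ Nat.coprime_two_left.2 hK)
  have hinv : Function.Involutive (MulAut.conjNormal s : MulAut K) := fun k => by
    rw [← MulAut.mul_apply, ← map_mul, ← sq, ← hs, pow_orderOf_eq_one, map_one, MulAut.one_apply]
  exact congrFun (hfree.coe_eq_inv_of_involutive hinv) a

theorem exists_commute_orderOf_eq_two [Finite G] (hG : HasPrimeOrders G) (h : 4 ∣ Nat.card G) :
    ∃ s t : G, orderOf s = 2 ∧ orderOf t = 2 ∧ s ≠ t ∧ Commute s t := by
  classical
  obtain ⟨K, hK, hpow⟩ :=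
    hG.exists_subgroup_card_eq_pow_forall_pow_eq_one (n := 2) Nat.prime_two h
  obtain ⟨s, hs⟩ := exists_notMem_of_card_lt {(1 : K)} (by rw [hK, Finset.card_singleton]; norm_num)
  obtain ⟨t, ht⟩ := exists_notMem_of_card_lt {1, s}
    (Finset.card_le_two.trans_lt (by rw [hK]; norm_num))
  simp only [Finset.mem_insert, Finset.mem_singleton, not_or] at hs ht
  refine ⟨s, t, ?_, ?_, fun hst => ht.2 (Subtype.ext hst.symm), ?_⟩
  · rw [Subgroup.orderOf_coe, orderOf_eq_prime (hpow s) hs]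
  · rw [Subgroup.orderOf_coe, orderOf_eq_prime (hpow t) ht.1]
  · exact (Commute.of_orderOf_dvd_two (fun k => orderOf_dvd_of_pow_eq_one (hpow k)) s t).map
      K.subtype

theorem eq_bot_of_normal_of_odd_card [Finite G] (hG : HasPrimeOrders G) (h4 : 4 ∣ Nat.card G)
    (K : Subgroup G) [K.Normal] (hK : Odd (Nat.card K)) : K = ⊥ := by
  obtain ⟨s, t, hs, ht, hst, hcomm⟩ := hG.exists_commute_orderOf_eq_two h4
  have hs2 : s ^ 2 = 1 := hs ▸ pow_orderOf_eq_one s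
  have ht2 : t ^ 2 = 1 := ht ▸ pow_orderOf_eq_one t
  have hne : s * t ≠ 1 := fun h => hst <| by
    rw [mul_eq_one_iff_eq_inv.1 h, inv_eq_of_mul_eq_one_left (by rw [← sq, ht2])]
  have hord : orderOf (s * t) = 2 :=
    orderOf_eq_prime (by rw [hcomm.mul_pow, hs2, ht2, one_mul]) hne
  have hfree := hG.fixedPointFree_conjNormal hne (hord ▸ Nat.coprime_two_left.2 hK)
  -- `s` and `t` both invert `K`, so `s * t` centralizes `K`.
  refine K.eq_bot_iff_forall.2 fun a ha => ?_
  have h1 := hfree ⟨a, ha⟩ <| by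
    rw [map_mul, MulAut.mul_apply, hG.conjNormal_eq_inv hK ht, hG.conjNormal_eq_inv hK hs, inv_inv]
  simpa using h1

theorem card_ne_fifteen (hG : HasPrimeOrders G) : Nat.card G ≠ 15 := by
  intro h
  have : Finite G := Nat.finite_of_card_ne_zero (by omega)
  obtain ⟨K, _, hK⟩ := exists_normal_card_eq_of_minFac (G := G) (p := 3) (m := 5) h (by norm_num)
    (by norm_num [h])
  have := hG.card_modEq_one_of_normal Nat.prime_three (by norm_num [h]) K (by norm_num [hK])
  rw [hK] at this
  exact absurd this (by decide)

theorem card_ne_thirty (hG : HasPrimeOrders G) : Nat.card G ≠ 30 := by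
  intro h
  have : Finite G := Nat.finite_of_card_ne_zero (by omega)
  obtain ⟨K, -, hK⟩ := exists_normal_card_eq_of_minFac (G := G) (p := 2) (m := 15) h (by norm_num)
    (by norm_num [h])
  exact (hG.subgroup K).card_ne_fifteen hK

theorem sylow_two_eq_top_of_normalizer_le_centralizer [Finite G] (hG : HasPrimeOrders G)
    (h4 : 4 ∣ Nat.card G) (P : Sylow 2 G)
    (hP : Subgroup.normalizer (P : Set G) ≤ Subgroup.centralizer (P : Set G)) :
    (P : Subgroup G) = ⊤ := by
  have hbot := hG.eq_bot_of_normal_of_odd_card h4 (MonoidHom.transferSylow P hP).ker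
    (Nat.not_even_iff_odd.1 fun h =>
      MonoidHom.not_dvd_card_ker_transferSylow P hP (even_iff_two_dvd.1 h))
  have hcompl := MonoidHom.ker_transferSylow_isComplement' P hP
  rwa [hbot, Subgroup.isComplement'_bot_left] at hcompl

theorem card_normalizer_sylow_two [Finite G] (hG : HasPrimeOrders G) {m : ℕ}
    (hcard : Nat.card G = 4 * m) (hm : m ∣ 15) (hm1 : m ≠ 1) (P : Sylow 2 G) :
    Nat.card (Subgroup.normalizer (P : Set G)) = 12 := by
  have hm2 : ¬ 2 ∣ m := fun h => absurd (h.trans hm) (by norm_num)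
  have hP : Nat.card (P : Subgroup G) = 4 := card_sylow_eq_of_card_eq_pow_mul (k := 2) P hcard hm2
  have hPN : (P : Subgroup G) ≤ Subgroup.normalizer (P : Set G) := Subgroup.le_normalizer
  obtain ⟨d, hd⟩ := hP ▸ Subgroup.card_dvd_of_le hPN
  have hd1 : d ≠ 1 := by
    rintro rfl
    have hNP : (P : Subgroup G) = Subgroup.normalizer (P : Set G) :=
      Subgroup.eq_of_le_of_card_ge hPN (by rw [hd, hP])
    have : IsMulCommutative (P : Subgroup G) :=
      IsPGroup.isMulCommutative_of_card_eq_prime_sq (p := 2) hP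
    have htop := hG.sylow_two_eq_top_of_normalizer_le_centralizer ⟨m, hcard⟩ P
      (hNP ▸ Subgroup.le_centralizer _)
    rw [htop, Subgroup.card_top] at hP
    omega
  have hd5 : ¬ 5 ∣ d := by
    intro h5
    have := hG.card_modEq_one_of_dvd_card_normalizer Nat.prime_five (P : Subgroup G)
      (hd ▸ h5.mul_left 4) (by norm_num [hP])
    rw [hP] at this
    exact absurd this (by decide)
  have hd15 : d ∣ 15 := by
    have h := Subgroup.card_subgroup_dvd_card (Subgroup.normalizer (P : Set G))
    rw [hd, hcard] at h
    exact (Nat.dvd_of_mul_dvd_mul_left (by norm_num) h).trans hm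
  have hd3 : d = 3 := by
    have hle : d ≤ 15 := Nat.le_of_dvd (by norm_num) hd15
    interval_cases d <;> omega
  rw [hd, hd3]

theorem card_ne_twenty (hG : HasPrimeOrders G) : Nat.card G ≠ 20 := by
  intro h
  have : Finite G := Nat.finite_of_card_ne_zero (by omega)
  obtain ⟨P⟩ : Nonempty (Sylow 2 G) := inferInstance
  have hN := Subgroup.card_subgroup_dvd_card (Subgroup.normalizer (P : Set G))
  rw [hG.card_normalizer_sylow_two (m := 5) h (by norm_num) (by norm_num), h] at hN
  norm_num at hN

end HasPrimeOrders

section DihedralLift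

variable {G : Type*} [Group G] {n : ℕ} {a b : G}

/-- The homomorphism from `ℤ/n`, written multiplicatively, sending the class of `k` to `a ^ k`. -/
def zmodPowHom (ha : a ^ n = 1) : Multiplicative (ZMod n) →* G :=
  AddMonoidHom.toMultiplicativeLeft
    (ZMod.lift n ⟨zmultiplesHom (Additive G) (.ofMul a), by simp [← ofMul_pow, ha]⟩)

theorem zmodPowHom_ofAdd_intCast (ha : a ^ n = 1) (k : ℤ) :
    zmodPowHom ha (.ofAdd (k : ZMod n)) = a ^ k := by
  simp [zmodPowHom]

theorem mul_zmodPowHom_ofAdd (ha : a ^ n = 1) (hab : b * a * b⁻¹ = a⁻¹) (i : ZMod n) :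
    b * zmodPowHom ha (.ofAdd i) = zmodPowHom ha (.ofAdd (-i)) * b := by
  obtain ⟨k, rfl⟩ := ZMod.intCast_surjective i
  rw [ofAdd_neg, map_inv, zmodPowHom_ofAdd_intCast, ← mul_inv_eq_iff_eq_mul, ← conj_zpow, hab,
    inv_zpow]

/-- The homomorphism from the dihedral group given by its presentation: it sends the rotation `r 1`
to `a` and the reflection `sr 0` to `b`. -/
def dihedralLift (ha : a ^ n = 1) (hb : b ^ 2 = 1) (hab : b * a * b⁻¹ = a⁻¹) :
    DihedralGroup n →* G where
  toFun
    | .r i => zmodPowHom ha (.ofAdd i)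
    | .sr i => b * zmodPowHom ha (.ofAdd i)
  map_one' := map_one _
  map_mul' := by
    have hr (i : ZMod n) : zmodPowHom ha (.ofAdd i) * b = b * zmodPowHom ha (.ofAdd (-i)) := by
      rw [mul_zmodPowHom_ofAdd ha hab, neg_neg]
    rintro (i | i) (j | j)
    · exact map_mul _ _ _
    · simp only [DihedralGroup.r_mul_sr]
      rw [← mul_assoc, hr, mul_assoc, ← map_mul, ← ofAdd_add, neg_add_eq_sub]
    · simp only [DihedralGroup.sr_mul_r, ofAdd_add, map_mul, mul_assoc]
    · simp only [DihedralGroup.sr_mul_sr]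
      rw [mul_assoc, ← mul_assoc (zmodPowHom ha _), hr, ← mul_assoc, ← mul_assoc, ← sq, hb, one_mul,
        ← map_mul, ← ofAdd_add, neg_add_eq_sub]

theorem dihedralLift_injective (ha : orderOf a = n) (hb : b ^ 2 = 1) (hab : b * a * b⁻¹ = a⁻¹)
    (hba : b ∉ Subgroup.zpowers a) :
    Function.Injective (dihedralLift (orderOf_dvd_iff_pow_eq_one.1 ha.dvd) hb hab) := by
  have hn : a ^ n = 1 := orderOf_dvd_iff_pow_eq_one.1 ha.dvd
  refine (injective_iff_map_eq_one _).2 ?_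
  rintro (i | i) h
  all_goals obtain ⟨k, rfl⟩ := ZMod.intCast_surjective i
  · have hk : a ^ k = 1 := (zmodPowHom_ofAdd_intCast hn k).symm.trans h
    rw [← orderOf_dvd_iff_zpow_eq_one, ha] at hk
    rw [(ZMod.intCast_zmod_eq_zero_iff_dvd _ _).2 hk, DihedralGroup.r_zero]
  · have hk : b * a ^ k = 1 := (congrArg (b * ·) (zmodPowHom_ofAdd_intCast hn k)).symm.trans h
    refine absurd ?_ hba
    rw [mul_eq_one_iff_eq_inv.1 hk]
    exact inv_mem (zpow_mem (Subgroup.mem_zpowers a) k)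

theorem nonempty_mulEquiv_dihedralGroup_of_orderOf_eq [Finite G] (ha : orderOf a = n)
    (hb : b ^ 2 = 1) (hab : b * a * b⁻¹ = a⁻¹) (hba : b ∉ Subgroup.zpowers a)
    (hcard : Nat.card G = 2 * n) :
    Nonempty (G ≃* DihedralGroup n) := by
  have hinj := dihedralLift_injective ha hb hab hba
  have : Finite (DihedralGroup n) := Finite.of_injective _ hinj
  exact ⟨(MulEquiv.ofBijective _ ((Nat.bijective_iff_injective_and_card _).2
    ⟨hinj, by rw [hcard, DihedralGroup.nat_card]⟩)).symm⟩

end DihedralLift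

theorem nonempty_mulEquiv_alternatingGroup_of_normalCore_eq_bot {G : Type*} [Group G]
    [Finite G] {n : ℕ} (N : Subgroup G) (hn : N.index = n) (hcore : N.normalCore = ⊥)
    (hcard : Nat.card G * 2 = n.factorial) :
    Nonempty (G ≃* alternatingGroup (Fin n)) := by
  classical
  have : Fintype (G ⧸ N) := Fintype.ofFinite _
  let φ := MulAction.toPermHom G (G ⧸ N)
  have hφ : Function.Injective φ := by
    rw [← MonoidHom.ker_eq_bot_iff, ← Subgroup.normalCore_eq_ker, hcore]
  have hrange : φ.range.index = 2 := by
    have h := φ.range.card_mul_index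
    rw [← Nat.card_congr (MonoidHom.ofInjective hφ).toEquiv, Nat.card_perm, ← Subgroup.index, hn,
      ← hcard] at h
    exact Nat.eq_of_mul_eq_mul_left Nat.card_pos h
  exact ⟨(MonoidHom.ofInjective hφ).trans <|
    (MulEquiv.subgroupCongr (eq_alternatingGroup_of_index_eq_two hrange)).trans <|
    Equiv.altCongrHom (Finite.equivFinOfCardEq hn)⟩

namespace HasPrimeOrders

variable {G : Type*} [Group G] [Finite G]

theorem nonempty_mulEquiv_dihedralGroup (hG : HasPrimeOrders G) {p : ℕ} (hp : p.Prime)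
    (h : Nat.card G = 2 * p) : Nonempty (G ≃* DihedralGroup p) := by
  have : Fact p.Prime := ⟨hp⟩
  rcases hp.eq_two_or_odd' with rfl | hodd
  · obtain ⟨a, b, ha, hb, hne, hcomm⟩ := hG.exists_commute_orderOf_eq_two (by rw [h])
    refine nonempty_mulEquiv_dihedralGroup_of_orderOf_eq (b := b) ha (hb ▸ pow_orderOf_eq_one b)
      ?_ ?_ h
    · rw [hcomm.symm.eq, mul_inv_cancel_right, eq_inv_iff_mul_eq_one, ← sq, ← ha,
        pow_orderOf_eq_one]
    · classical
      rw [mem_zpowers_iff_mem_range_orderOf, ha]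
      have hb1 : b ≠ 1 := orderOf_eq_one_iff.not.1 (by omega)
      simpa [Finset.range_add_one] using ⟨hne.symm, hb1⟩
  · have h2p : ¬ 2 ∣ p := fun h2 => Nat.not_even_iff_odd.2 hodd (even_iff_two_dvd.2 h2)
    obtain ⟨K, _, hK⟩ := exists_normal_card_eq_of_minFac h h2p
      ((Nat.minFac_eq_two_iff _).2 ⟨p, h⟩)
    obtain ⟨b, hb⟩ := exists_prime_orderOf_dvd_card' (G := G) 2 ⟨p, h⟩
    obtain ⟨a, ha⟩ := exists_prime_orderOf_dvd_card' (G := K) p hK.symm.dvd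
    refine nonempty_mulEquiv_dihedralGroup_of_orderOf_eq (a := (a : G)) (b := b)
      (by rw [Subgroup.orderOf_coe, ha]) (hb ▸ pow_orderOf_eq_one b) ?_ (fun hba => h2p ?_) h
    · exact congrArg Subtype.val (hG.conjNormal_eq_inv (hK ▸ hodd) hb a)
    · rw [← hb, ← hK]
      exact Subgroup.orderOf_dvd_natCard K (Subgroup.zpowers_le.2 a.2 hba)

theorem nonempty_mulEquiv_alternatingGroup_four (hG : HasPrimeOrders G) (h : Nat.card G = 12) :
    Nonempty (G ≃* alternatingGroup (Fin 4)) := by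
  obtain ⟨N, hN⟩ := Sylow.exists_subgroup_card_pow_prime (G := G) 3 (n := 1) (by norm_num [h])
  have hindex : N.index = 4 := by
    have := N.card_mul_index
    rw [hN, h] at this
    omega
  have hodd : Odd (Nat.card N.normalCore) :=
    Odd.of_dvd_nat (hN ▸ by decide) (Subgroup.card_dvd_of_le N.normalCore_le)
  exact nonempty_mulEquiv_alternatingGroup_of_normalCore_eq_bot N hindex
    (hG.eq_bot_of_normal_of_odd_card (by norm_num [h]) _ hodd) (by rw [h]; rfl)

theorem card_ne_six_of_normal (hG : HasPrimeOrders G) (h : Nat.card G = 60) (K : Subgroup G)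
    [K.Normal] : Nat.card K ≠ 6 := by
  intro hK
  have : Fact (Nat.Prime 5) := ⟨Nat.prime_five⟩
  have hQ : Nat.card (G ⧸ K) = 10 := by
    have := K.card_eq_card_quotient_mul_card_subgroup
    rw [h, hK] at this
    omega
  obtain ⟨L, hL⟩ := Sylow.exists_subgroup_card_pow_prime (G := G ⧸ K) 5 (n := 1)
    (by norm_num [hQ])
  have hLindex : L.index = 2 := by
    have := L.card_mul_index
    rw [hL, hQ] at this
    omega
  have hcomap := (L.comap (QuotientGroup.mk' K)).card_mul_index
  rw [Subgroup.index_comap_of_surjective L (QuotientGroup.mk'_surjective K), hLindex, h] at hcomap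
  exact (hG.subgroup (L.comap (QuotientGroup.mk' K))).card_ne_thirty (by omega)

theorem nonempty_mulEquiv_alternatingGroup_five (hG : HasPrimeOrders G) (h : Nat.card G = 60) :
    Nonempty (G ≃* alternatingGroup (Fin 5)) := by
  obtain ⟨P⟩ : Nonempty (Sylow 2 G) := inferInstance
  have hN := hG.card_normalizer_sylow_two (m := 15) h dvd_rfl (by norm_num) P
  set N := Subgroup.normalizer (P : Set G)
  have hindex : N.index = 5 := by
    have := N.card_mul_index
    rw [hN, h] at this
    omega
  have hdvd : Nat.card N.normalCore ∣ 12 := hN ▸ Subgroup.card_dvd_of_le N.normalCore_le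
  have hmod : Nat.card N.normalCore % 5 = 1 :=
    hG.card_modEq_one_of_normal Nat.prime_five (by norm_num [h]) N.normalCore
      fun h5 => absurd (h5.trans hdvd) (by norm_num)
  have hcard : Nat.card N.normalCore = 1 := by
    have hne := hG.card_ne_six_of_normal h N.normalCore
    have hle := Nat.le_of_dvd (by norm_num) hdvd
    interval_cases Nat.card N.normalCore <;> omega
  exact nonempty_mulEquiv_alternatingGroup_of_normalCore_eq_bot N hindex
    (Subgroup.card_eq_one.1 hcard) (by rw [h]; rfl)

end HasPrimeOrders

namespace alternatingGroupFive

theorem exists_injective_of_prime_card {H : Type*} [Group H] {p : ℕ} (hp : p.Prime) (hp60 : p ∣ 60)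
    (h : Nat.card H = p) : ∃ φ : H →* alternatingGroup (Fin 5), Function.Injective φ := by
  have : Fact p.Prime := ⟨hp⟩
  obtain ⟨a, ha⟩ :=
    exists_prime_orderOf_dvd_card' (G := alternatingGroup (Fin 5)) p (nat_card ▸ hp60)
  let e : H ≃* Subgroup.zpowers a := mulEquivOfPrimeCardEq h ((Nat.card_zpowers a).trans ha)
  exact ⟨(Subgroup.zpowers a).subtype.comp e.toMonoidHom,
    (Subgroup.zpowers a).subtype_injective.comp e.injective⟩

theorem exists_injective_dihedralGroup {p : ℕ} (hp : p = 2 ∨ p = 3 ∨ p = 5) :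
    ∃ φ : DihedralGroup p →* alternatingGroup (Fin 5), Function.Injective φ := by
  have : Fact (Nat.Prime 5) := ⟨Nat.prime_five⟩
  obtain ⟨a, b, ha, hb, hab, hba⟩ : ∃ a b : alternatingGroup (Fin 5),
      orderOf a = p ∧ b ^ 2 = 1 ∧ b * a * b⁻¹ = a⁻¹ ∧ ∀ k < p, a ^ k ≠ b := by
    rcases hp with rfl | rfl | rfl
    · exact ⟨⟨c[0, 1] * c[2, 3], mem_alternatingGroup.2 (by decide +kernel)⟩,
        ⟨c[0, 2] * c[1, 3], mem_alternatingGroup.2 (by decide +kernel)⟩,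
        orderOf_eq_prime (by decide +kernel) (by decide +kernel), by decide +kernel,
        by decide +kernel, by decide +kernel⟩
    · exact ⟨⟨c[0, 1, 2], mem_alternatingGroup.2 (by decide +kernel)⟩,
        ⟨c[0, 1] * c[3, 4], mem_alternatingGroup.2 (by decide +kernel)⟩,
        orderOf_eq_prime (by decide +kernel) (by decide +kernel), by decide +kernel,
        by decide +kernel, by decide +kernel⟩
    · exact ⟨⟨c[0, 1, 2, 3, 4], mem_alternatingGroup.2 (by decide +kernel)⟩,
        ⟨c[1, 4] * c[2, 3], mem_alternatingGroup.2 (by decide +kernel)⟩,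
        orderOf_eq_prime (by decide +kernel) (by decide +kernel), by decide +kernel,
        by decide +kernel, by decide +kernel⟩
  exact ⟨_, dihedralLift_injective ha hb hab (by
    simpa [mem_zpowers_iff_mem_range_orderOf, ha] using hba)⟩

theorem exists_injective_alternatingGroup_four :
    ∃ φ : alternatingGroup (Fin 4) →* alternatingGroup (Fin 5), Function.Injective φ := by
  let e : Fin 4 ≃ ({0, 1, 2, 3} : Finset (Fin 5)) := Fintype.equivOfCardEq (by decide)
  exact ⟨(alternatingGroup.ofSubtype _).comp (Equiv.altCongrHom e).toMonoidHom,
    alternatingGroup.ofSubtype_injective.comp (Equiv.altCongrHom e).injective⟩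

theorem exists_injective_of_card_dvd_sixty {H : Type*} [Group H] [Finite H] (hH : HasPrimeOrders H)
    (hcard : Nat.card H ∣ 60) : ∃ φ : H →* alternatingGroup (Fin 5), Function.Injective φ := by
  have hmem := Nat.mem_divisors.2 ⟨hcard, by norm_num⟩
  rw [show Nat.divisors 60 = {1, 2, 3, 4, 5, 6, 10, 12, 15, 20, 30, 60} by decide +kernel] at hmem
  simp only [Finset.mem_insert, Finset.mem_singleton] at hmem
  have of_mulEquiv {K : Type} [Group K] (e : H ≃* K)
      (h : ∃ φ : K →* alternatingGroup (Fin 5), Function.Injective φ) :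
      ∃ φ : H →* alternatingGroup (Fin 5), Function.Injective φ :=
    h.imp' (fun φ => φ.comp e.toMonoidHom) fun φ hφ => hφ.comp e.injective
  have dihedral (p : ℕ) (hp : p = 2 ∨ p = 3 ∨ p = 5) (h : Nat.card H = 2 * p) :
      ∃ φ : H →* alternatingGroup (Fin 5), Function.Injective φ := by
    have hprime : p.Prime := by rcases hp with rfl | rfl | rfl <;> norm_num
    obtain ⟨e⟩ := hH.nonempty_mulEquiv_dihedralGroup hprime h
    exact of_mulEquiv e (exists_injective_dihedralGroup hp)
  rcases hmem with h | h | h | h | h | h | h | h | h | h | h | h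
  · have := (Nat.card_eq_one_iff_unique.1 h).1
    exact ⟨1, Function.injective_of_subsingleton _⟩
  · exact exists_injective_of_prime_card Nat.prime_two (by norm_num) h
  · exact exists_injective_of_prime_card Nat.prime_three (by norm_num) h
  · exact dihedral 2 (by norm_num) h
  · exact exists_injective_of_prime_card Nat.prime_five (by norm_num) h
  · exact dihedral 3 (by norm_num) h
  · exact dihedral 5 (by norm_num) h
  · obtain ⟨e⟩ := hH.nonempty_mulEquiv_alternatingGroup_four h
    exact of_mulEquiv e exists_injective_alternatingGroup_four
  · exact absurd h hH.card_ne_fifteen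
  · exact absurd h hH.card_ne_twenty
  · exact absurd h hH.card_ne_thirty
  · obtain ⟨e⟩ := hH.nonempty_mulEquiv_alternatingGroup_five h
    exact ⟨e.toMonoidHom, e.injective⟩

theorem isSection_of_basisA5 {H : Type*} [Group H] (h : ∀ δ ∈ DIdentity.basisA5, δ.HoldsIn H) :
    IsSection H (alternatingGroup (Fin 5)) := by
  simp only [DIdentity.basisA5, Set.mem_insert_iff, Set.mem_singleton_iff, forall_eq_or_imp,
    forall_eq] at h
  obtain ⟨hω, hα, hβ, hγ, hε⟩ := h
  have : Finite H := DIdentity.finite_of_omega_holdsIn hω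
  have hH : HasPrimeOrders H := .of_pow_eq_one (DIdentity.alpha_holdsIn_iff.1 hα)
  obtain ⟨φ, hφ⟩ := exists_injective_of_card_dvd_sixty hH (card_dvd_sixty hα hβ hγ hε)
  exact .of_injective hφ

end alternatingGroupFive

theorem theorem1 :
    IsDBasis.{u, 0} DIdentity.basisA5 (alternatingGroup (Fin 5)) ∧
      ∀ (H : Type u) [Group H], (∀ δ ∈ DIdentity.basisA5, δ.HoldsIn H) →
        IsSection H (alternatingGroup (Fin 5)) := by
  have h (H : Type u) [Group H] (hH : ∀ δ ∈ DIdentity.basisA5, δ.HoldsIn H) :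
      IsSection H (alternatingGroup (Fin 5)) :=
    alternatingGroupFive.isSection_of_basisA5 hH
  exact ⟨⟨alternatingGroupFive.basisA5_holdsIn, fun H _ hH => .of_isSection (h H hH)⟩, h⟩
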